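/- **Setting.** A seller faces a horizon of $T$ time steps, $K$ prices and a price protection period of $M$ steps. A *$K$-price instance* consists of prices $0\le p_1<\dots<p_K\le 1$ and, for each $k\in[K]$, a probability distribution on $[0,1]$ (the demand distribution at price $p_k$) with mean $\mu_k$; put $\lambda_k=p_k\mu_k$. In step $t=1,\dots,T$ the seller offers a price $p_{i_t}$ and then observes a demand $D_t(p_{i_t})\in[0,1]$ drawn from the demand distribution at $p_{i_t}$, independently of the past given $i_t$. A (possibly randomized) *non-anticipatory policy* $\pi$ knows the prices $p_1,\dots,p_K$ (but not the demand distributions) and draws $i_t$ from a distribution that depends measurably on the history $(i_s,D_s(p_{i_s}))_{s<t}$ only (the refunds of earlier steps are functions of this history and the prices). A customer of step $t$ finally pays the lowest price offered in steps $t,\dots,t+M$, so the regret of $\pi$ on the instance is $$\mathrm{Regret}(\pi)=T\max_{k\in[K]}\lambda_k-\mathbb E\Big[\sum_{t=1}^{T}\min\{p_{i_s}: t\le s\le \min(t+M,T)\}\,D_t(p_{i_t})\Big].$$ **Theorem.** There is an absolute constant $c>0$ such that for all integers $K,M,T$ with $2\le K<M\le T$ and every non-anticipatory policy $\pi$ there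 is a $K$-price instance on which $$\mathrm{Regret}(\pi)\ \ge\ c\left(\sqrt{KT}+\min\{M,\;K^{1/3}T^{2/3}\}\right).$$ -/

import Mathlib

open MeasureTheory ProbabilityTheory

noncomputable section

namespace PriceProtection

/-- The record of `t` completed time steps with `K` prices: entry `s` is the index `i_s` of the
price offered in step `s` and the demand `D_s(p_{i_s})` observed in that step. The refunds paid so
far are functions of this record and of the price vector, so they carry no further information. -/
abbrev History (K t : ℕ) : Type := Fin t → Fin K × ℝ

/-- A `K`-price instance: distinct prices in `[0,1]`, labelled in increasing order, and for each
price the distribution of the (i.i.d. over time) demand at that price, supported in `[0,1]`. -/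
structure PricingInstance (K : ℕ) where
  /-- the prices `p_1 < ... < p_K` -/
  price : Fin K → ℝ
  price_mem : ∀ k, price k ∈ Set.Icc (0 : ℝ) 1
  price_strictMono : StrictMono price
  /-- the law of the demand at each price -/
  demand : Fin K → Measure ℝ
  demand_prob : ∀ k, IsProbabilityMeasure (demand k)
  demand_mem : ∀ k, ∀ᵐ x ∂(demand k), x ∈ Set.Icc (0 : ℝ) 1

/-- A possibly randomized non-anticipatory pricing policy. It knows the price vector, and after
`t` completed steps it draws the index of the next price from a probability distribution that
depends (measurably) on the history only. -/
structure Policy (K : ℕ) where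
  choose : (Fin K → ℝ) → (t : ℕ) → Kernel (History K t) (Fin K)
  markov : ∀ p t, IsMarkovKernel (choose p t)

variable {K : ℕ}

/-- `μ_k`, the expected demand at price `k`. -/
def PricingInstance.mean (I : PricingInstance K) (k : Fin K) : ℝ := ∫ x, x ∂(I.demand k)

/-- `λ_k = p_k μ_k`, the expected one-step reward of price `k`. -/
def PricingInstance.reward (I : PricingInstance K) (k : Fin K) : ℝ := I.price k * I.mean k

/-- The law of the next step given the past: the policy draws a price index, and then the demand
is drawn from the demand law of that price, independently of the past. -/
def stepKernel (I : PricingInstance K) (π : Policy K) (t : ℕ) :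
    Kernel (History K t) (Fin K × ℝ) :=
  (π.choose I.price t).compProd
    (Kernel.prodMkLeft (History K t) (Kernel.ofFunOfCountable I.demand))

/-- Append one step to a history. -/
def History.snoc {t : ℕ} (x : History K t × (Fin K × ℝ)) : History K (t + 1) :=
  Fin.snoc (α := fun _ => Fin K × ℝ) x.1 x.2

theorem History.measurable_snoc {t : ℕ} :
    Measurable (History.snoc : History K t × (Fin K × ℝ) → History K (t + 1)) := by
  refine measurable_pi_lambda _ (fun j => ?_)
  induction j using Fin.lastCases with
  | last => simpa [History.snoc] using measurable_snd
  | cast j =>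
    have h : Measurable (fun x : History K t × (Fin K × ℝ) => x.1 j) :=
      (measurable_pi_apply j).comp measurable_fst
    simpa [History.snoc] using h

/-- The law of the history of the first `t` steps when `π` is run on the instance `I`. -/
def historyLaw (I : PricingInstance K) (π : Policy K) : (t : ℕ) → Measure (History K t)
  | 0 => Measure.dirac (fun s => s.elim0)
  | t + 1 => ((historyLaw I π t).compProd (stepKernel I π t)).map History.snoc

instance (I : PricingInstance K) (π : Policy K) (t : ℕ) : IsMarkovKernel (stepKernel I π t) := by
  have h1 := π.markov I.price t
  have h2 : IsMarkovKernel (Kernel.ofFunOfCountable I.demand) := ⟨I.demand_prob⟩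
  unfold stepKernel
  infer_instance

instance (I : PricingInstance K) (π : Policy K) (t : ℕ) :
    IsProbabilityMeasure (historyLaw I π t) := by
  induction t with
  | zero => unfold historyLaw; infer_instance
  | succ t ih =>
    unfold historyLaw
    exact Measure.isProbabilityMeasure_map History.measurable_snoc.aemeasurable

/-- The final price paid per unit by the customers of step `t` under a price protection period of
`M` steps: `min {p_{i_t}, ..., p_{i_{t+M}}}`, where only steps within the horizon `T` occur. -/
def finalPrice {T : ℕ} (M : ℕ) (p : Fin K → ℝ) (h : History K T) (t : Fin T) : ℝ :=
  (Finset.univ.filter (fun s : Fin T => (t : ℕ) ≤ s ∧ (s : ℕ) ≤ t + M)).inf'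
    ⟨t, by simp⟩ (fun s => p (h s).1)

/-- The total revenue over the horizon, net of all refunds. -/
def revenue {T : ℕ} (M : ℕ) (p : Fin K → ℝ) (h : History K T) : ℝ :=
  ∑ t : Fin T, finalPrice M p h t * (h t).2

/-- The expected regret of `π` on `I` with horizon `T` and protection period `M`:
`T * max_k λ_k` minus the expected total revenue. -/
def regret (M T : ℕ) (I : PricingInstance K) (π : Policy K) : ℝ :=
  T * (⨆ k, I.reward k) - ∫ h, revenue M I.price h ∂(historyLaw I π T)

end PriceProtection

end

open MeasureTheory ProbabilityTheory

namespace PriceProtection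

/-! ### Histories: one-step recursion, marginals, support of the demands -/

variable {K : ℕ}

/-! It suffices to prove the two lower bounds separately, since the larger is at least half the sum.
Both use one family of instances: a low price of known reward 1/2, and k = K - 1 high prices of
reward 1/2 - δ, of which at most one, j, is raised to 1/2 + δ. With a budget Y of high offers, δ is
of order √(K/Y), so that about Y/K samples do not reveal whether j is good.

Run the policy on the instance without a good price and look at the first half of the horizon. If
high offers number at most Y/6 with probability at least 1/2, some j is rarely sampled, and a change
of measure (`measure_historyLaw_le`) shows that the same behaviour has constant probability when j
is good; there, a constant fraction of the steps lose δ each (`exists_regret_ge_of_rare`). Otherwise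
exploration itself is costly (`regret_ge_of_often`).

For Y = T the cost of exploration is δT/6, which gives √(KT). For Y = X = min(M, K^{1/3}T^{2/3}) it
comes from refunds: a low offer in the second half triggers at least min(M, X/6) of them
(`min_le_refundCount`), each costing at least 1/16, while never returning to the low price costs
δT/2. The condition X³ ≤ KT² says exactly that √(K/X)·T, and so δT, is at least of order X. -/

/-- The sequence of offered prices in a history. -/
def History.offers {t : ℕ} (h : History K t) : Fin t → Fin K := fun s => (h s).1

theorem History.measurable_offers {t : ℕ} :
    Measurable (History.offers : History K t → Fin t → Fin K) :=
  measurable_pi_lambda _ fun s => (measurable_pi_apply s).fst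

@[simp] theorem History.snoc_castSucc {t : ℕ} (x : History K t × (Fin K × ℝ)) (s : Fin t) :
    History.snoc x s.castSucc = x.1 s := by simp [History.snoc]

@[simp] theorem History.snoc_last {t : ℕ} (x : History K t × (Fin K × ℝ)) :
    History.snoc x (Fin.last t) = x.2 := by simp [History.snoc]

/-- The first `t` steps of a history. -/
def History.take {t T : ℕ} (hT : t ≤ T) (h : History K T) : History K t :=
  fun s => h (Fin.castLE hT s)

theorem History.measurable_take {t T : ℕ} (hT : t ≤ T) :
    Measurable (History.take hT : History K T → History K t) :=
  measurable_pi_lambda _ fun _ => measurable_pi_apply _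

theorem lintegral_historyLaw_succ (I : PricingInstance K) (π : Policy K) (t : ℕ)
    {f : History K (t + 1) → ENNReal} (hf : Measurable f) :
    ∫⁻ h, f h ∂(historyLaw I π (t + 1)) =
      ∫⁻ h, ∫⁻ x, f (History.snoc (h, x)) ∂(stepKernel I π t h) ∂(historyLaw I π t) := by
  rw [historyLaw, lintegral_map hf History.measurable_snoc,
    Measure.lintegral_compProd (f := fun x => f (History.snoc x))
      (hf.comp History.measurable_snoc)]

theorem lintegral_stepKernel (I : PricingInstance K) (π : Policy K) (t : ℕ) (h : History K t)
    {f : Fin K × ℝ → ENNReal} (hf : Measurable f) :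
    ∫⁻ x, f x ∂(stepKernel I π t h) =
      ∫⁻ i, ∫⁻ d, f (i, d) ∂(I.demand i) ∂(π.choose I.price t h) := by
  have h1 := π.markov I.price t
  have h2 : IsMarkovKernel (Kernel.ofFunOfCountable I.demand) := ⟨I.demand_prob⟩
  rw [stepKernel, Kernel.lintegral_compProd _ _ _ hf]
  simp [Kernel.prodMkLeft_apply, Kernel.ofFunOfCountable]

theorem historyLaw_succ_map_take (I : PricingInstance K) (π : Policy K) (t : ℕ) :
    (historyLaw I π (t + 1)).map (History.take t.le_succ) = historyLaw I π t := by
  rw [historyLaw, Measure.map_map (History.measurable_take _) History.measurable_snoc]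
  have : (History.take t.le_succ ∘ History.snoc :
      History K t × (Fin K × ℝ) → History K t) = Prod.fst := by
    funext x s
    exact History.snoc_castSucc x s
  rw [this]
  exact Measure.fst_compProd _ _

/-- Consistency of the laws: it lets events of the first half of the horizon be evaluated under the
shorter law. -/
theorem historyLaw_map_take (I : PricingInstance K) (π : Policy K) {t T : ℕ} (hT : t ≤ T) :
    (historyLaw I π T).map (History.take hT) = historyLaw I π t := by
  induction T, hT using Nat.le_induction with
  | base => exact Measure.map_id
  | succ T hT ih =>
    rw [← ih, ← historyLaw_succ_map_take I π T,
      Measure.map_map (History.measurable_take _) (History.measurable_take _)]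
    rfl

/-- The set `S` is left free because the refund bound needs demands in [1/4, 1], not merely in [0,
1]. -/
theorem ae_demand_mem (I : PricingInstance K) (π : Policy K) {S : Set ℝ} (hS : MeasurableSet S)
    (hI : ∀ k, ∀ᵐ x ∂(I.demand k), x ∈ S) (t : ℕ) :
    ∀ᵐ h ∂(historyLaw I π t), ∀ s, (h s).2 ∈ S := by
  have hmeas : ∀ t : ℕ, MeasurableSet {h : History K t | ∀ s, (h s).2 ∈ S} := by
    intro t
    rw [Set.ofPred_forall]
    exact MeasurableSet.iInter fun s => (measurable_pi_apply s).snd hS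
  induction t with
  | zero => exact Filter.Eventually.of_forall fun h s => s.elim0
  | succ t ih =>
    rw [historyLaw, ae_map_iff History.measurable_snoc.aemeasurable (hmeas _),
      Measure.ae_compProd_iff (p := fun x => ∀ s, (History.snoc x s).2 ∈ S)
        (History.measurable_snoc (hmeas _))]
    filter_upwards [ih] with h hh
    have h1 := π.markov I.price t
    have h2 : IsMarkovKernel (Kernel.ofFunOfCountable I.demand) := ⟨I.demand_prob⟩
    have key : ∀ᵐ x ∂(stepKernel I π t h), x.2 ∈ S := by
      rw [stepKernel, Kernel.ae_compProd_iff (measurable_snd hS)]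
      exact Filter.Eventually.of_forall fun i => hI i
    filter_upwards [key] with x hx s
    induction s using Fin.lastCases with
    | last => simpa using hx
    | cast s => simpa using hh s

/-! ### Regret as pseudo-regret plus refunds -/

theorem sum_offers_snoc {t : ℕ} (f : Fin K × ℝ → ℝ) (x : History K t × (Fin K × ℝ)) :
    ∑ s, f (History.snoc x s) = ∑ s, f (x.1 s) + f x.2 := by
  simp [Fin.sum_univ_castSucc]

/-- The centred revenues are martingale differences: given the past and the chosen index, the demand
has its own mean. Hence realized demands may be replaced by means in expectation. -/
theorem integral_sum_price_mul (I : PricingInstance K) (π : Policy K) (t : ℕ) :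
    Integrable (fun h : History K t => ∑ s, I.price (h s).1 * ((h s).2 - I.mean (h s).1))
        (historyLaw I π t) ∧
      ∫ h, ∑ s, I.price (h s).1 * ((h s).2 - I.mean (h s).1) ∂(historyLaw I π t) = 0 := by
  set f : Fin K × ℝ → ℝ := fun x => I.price x.1 * (x.2 - I.mean x.1) with hf
  have hfm : Measurable f :=
    ((Measurable.of_discrete (f := I.price)).comp measurable_fst).mul
      (measurable_snd.sub ((Measurable.of_discrete (f := I.mean)).comp measurable_fst))
  have hFm : ∀ t, Measurable (fun h : History K t => ∑ s, f (h s)) := fun t =>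
    Finset.measurable_sum _ fun s _ => hfm.comp (measurable_pi_apply s)
  have hmean : ∀ k, I.mean k ∈ Set.Icc (0 : ℝ) 1 := by
    intro k
    have := I.demand_prob k
    have hint : Integrable (fun x : ℝ => x) (I.demand k) :=
      Integrable.of_bound aestronglyMeasurable_id 1 (by
        filter_upwards [I.demand_mem k] with x hx
        rw [Real.norm_eq_abs, abs_le]; constructor <;> linarith [hx.1, hx.2])
    constructor
    · exact integral_nonneg_of_ae (by filter_upwards [I.demand_mem k] with x hx using hx.1)
    · calc I.mean k ≤ ∫ x, (1 : ℝ) ∂(I.demand k) :=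
            integral_mono_ae hint (integrable_const _)
              (by filter_upwards [I.demand_mem k] with x hx using hx.2)
        _ = 1 := by simp
  have hfb : ∀ x : Fin K × ℝ, x.2 ∈ Set.Icc (0 : ℝ) 1 → ‖f x‖ ≤ 1 := by
    intro x hx
    have h1 := I.price_mem x.1
    have h2 := hmean x.1
    rw [hf, Real.norm_eq_abs, abs_mul, abs_of_nonneg h1.1]
    have : |x.2 - I.mean x.1| ≤ 1 := by
      rw [abs_le]; constructor <;> linarith [hx.1, hx.2, h2.1, h2.2]
    exact mul_le_one₀ h1.2 (abs_nonneg _) this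
  have hint : ∀ t, Integrable (fun h : History K t => ∑ s, f (h s)) (historyLaw I π t) := by
    intro t
    refine Integrable.of_bound (hFm t).aestronglyMeasurable t ?_
    filter_upwards [ae_demand_mem I π measurableSet_Icc I.demand_mem t] with h hh
    calc ‖∑ s, f (h s)‖ ≤ ∑ s, ‖f (h s)‖ := norm_sum_le _ _
      _ ≤ ∑ s : Fin t, 1 := Finset.sum_le_sum fun s _ => hfb _ (hh s)
      _ = t := by simp
  refine ⟨hint t, ?_⟩
  change ∫ h : History K t, ∑ s, f (h s) ∂(historyLaw I π t) = 0
  induction t with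
  | zero => simp
  | succ t ih =>
    have hi := hint (t + 1)
    rw [historyLaw] at hi ⊢
    have hi' := (integrable_map_measure hi.1 History.measurable_snoc.aemeasurable).1 hi
    rw [integral_map History.measurable_snoc.aemeasurable hi.1]
    refine (Measure.integral_compProd hi').trans ?_
    rw [← ih]
    refine integral_congr_ae (Filter.Eventually.of_forall fun h => ?_)
    have h1 := π.markov I.price t
    have h2 : IsMarkovKernel (Kernel.ofFunOfCountable I.demand) := ⟨I.demand_prob⟩
    have hstep : ∀ᵐ x ∂(stepKernel I π t h), x.2 ∈ Set.Icc (0 : ℝ) 1 := by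
      rw [stepKernel, Kernel.ae_compProd_iff (measurable_snd measurableSet_Icc)]
      exact Filter.Eventually.of_forall fun i => I.demand_mem i
    have hfi : Integrable f (stepKernel I π t h) :=
      Integrable.of_bound hfm.aestronglyMeasurable 1
        (by filter_upwards [hstep] with x hx using hfb x hx)
    have hzero : ∫ x, f x ∂(stepKernel I π t h) = 0 := by
      rw [stepKernel] at hfi ⊢
      rw [integral_compProd hfi]
      refine integral_eq_zero_of_ae (Filter.Eventually.of_forall fun i => ?_)
      have := I.demand_prob i
      have hid : Integrable (fun x : ℝ => x) (I.demand i) :=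
        Integrable.of_bound aestronglyMeasurable_id 1 (by
          filter_upwards [I.demand_mem i] with x hx
          rw [Real.norm_eq_abs, abs_le]; constructor <;> linarith [hx.1, hx.2])
      change ∫ d, I.price i * (d - I.mean i) ∂(I.demand i) = 0
      rw [integral_const_mul, integral_sub hid (integrable_const _)]
      simp [PricingInstance.mean]
    simp only [Function.comp_apply, sum_offers_snoc]
    rw [integral_add (integrable_const _) hfi, hzero]
    simp

theorem integrable_offers (I : PricingInstance K) (π : Policy K) (T : ℕ)
    (g : (Fin T → Fin K) → ℝ) :
    Integrable (fun h : History K T => g h.offers) (historyLaw I π T) := by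
  obtain ⟨C, hC⟩ := (Set.finite_range fun o => ‖g o‖).bddAbove
  exact Integrable.of_bound
    ((Measurable.of_discrete (f := g)).comp History.measurable_offers).aestronglyMeasurable C
    (Filter.Eventually.of_forall fun h => hC ⟨_, rfl⟩)

theorem revenue_nonneg (I : PricingInstance K) (π : Policy K) (M T : ℕ) :
    0 ≤ᵐ[historyLaw I π T] revenue M I.price := by
  filter_upwards [ae_demand_mem I π measurableSet_Icc I.demand_mem T] with h hh
  refine Finset.sum_nonneg fun t _ => mul_nonneg ?_ (hh t).1
  exact Finset.le_inf' _ _ fun s _ => (I.price_mem _).1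

/-- Regret is at least the expected pseudo-regret plus any lower bound `r` on the refunds that
depends on the offered prices only. -/
theorem integral_le_regret (I : PricingInstance K) (π : Policy K) (M T : ℕ)
    (r : (Fin T → Fin K) → ℝ)
    (hr : ∀ᵐ h ∂(historyLaw I π T),
      revenue M I.price h + r h.offers ≤ ∑ s, I.price (h s).1 * (h s).2) :
    ∫ h : History K T, (∑ s, ((⨆ k, I.reward k) - I.reward (h.offers s)) + r h.offers)
      ∂(historyLaw I π T) ≤ regret M T I π := by
  obtain ⟨hi, h0⟩ := integral_sum_price_mul I π T
  have hdisc := integrable_offers I π T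
    (fun o => ∑ s, ((⨆ k, I.reward k) - I.reward (o s)) + r o)
  -- Only the upper bound has to be integrable here, so nonnegativity of the revenue replaces a
  -- proof of its integrability.
  have hrev := integral_mono_of_nonneg (revenue_nonneg I π M T)
    (hi.add ((integrable_const (T * ⨆ k, I.reward k)).sub hdisc)) (by
      filter_upwards [hr] with h hh
      simp only [Pi.add_apply, Pi.sub_apply, PricingInstance.reward, History.offers, mul_sub,
        Finset.sum_sub_distrib, Finset.sum_const, Finset.card_univ, Fintype.card_fin,
        nsmul_eq_mul] at hh ⊢
      linarith)
  rw [integral_add' hi ((integrable_const _).sub hdisc), h0,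
    integral_sub' (integrable_const _) hdisc, integral_const, probReal_univ, one_smul,
    zero_add] at hrev
  rw [regret]
  linarith

/-- If the pseudo-regret plus the refunds is at least `b` on an event, then the regret is at least
`b` times the probability of the event. -/
theorem mul_measure_le_regret (I : PricingInstance K) (π : Policy K) (M T : ℕ)
    (r : (Fin T → Fin K) → ℝ) (hr0 : ∀ o, 0 ≤ r o)
    (hr : ∀ᵐ h ∂(historyLaw I π T),
      revenue M I.price h + r h.offers ≤ ∑ s, I.price (h s).1 * (h s).2)
    (S : Set (Fin T → Fin K)) {b : ℝ}
    (hb : ∀ o ∈ S, b ≤ ∑ s, ((⨆ k, I.reward k) - I.reward (o s)) + r o) :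
    b * (historyLaw I π T).real (History.offers ⁻¹' S) ≤ regret M T I π := by
  refine le_trans ?_ (integral_le_regret I π M T r hr)
  set μ := historyLaw I π T
  have hS : MeasurableSet (History.offers ⁻¹' S : Set (History K T)) :=
    History.measurable_offers (MeasurableSet.of_discrete)
  set G : (Fin T → Fin K) → ℝ := fun o => ∑ s, ((⨆ k, I.reward k) - I.reward (o s)) + r o with hG
  have hG0 : ∀ o, 0 ≤ G o := fun o =>
    add_nonneg (Finset.sum_nonneg fun s _ =>
      sub_nonneg.2 (le_ciSup (Set.finite_range _).bddAbove _)) (hr0 o)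
  have hGi : Integrable (fun h : History K T => G h.offers) μ :=
    integrable_offers I π T G
  calc b * μ.real (History.offers ⁻¹' S)
      = ∫ h, (History.offers ⁻¹' S).indicator (fun _ => b) h ∂μ := by
        rw [integral_indicator_const _ hS, smul_eq_mul, mul_comm]
    _ ≤ ∫ h : History K T, G h.offers ∂μ := by
        refine integral_mono ((integrable_const b).indicator hS) hGi fun h => ?_
        by_cases hh : h.offers ∈ S
        · rw [Set.indicator_of_mem (show h ∈ History.offers ⁻¹' S from hh)]
          exact hb _ hh
        · rw [Set.indicator_of_notMem (show h ∉ History.offers ⁻¹' S from hh)]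
          exact hG0 _

/-! ### Change of measure when one demand law is altered -/

/-- The number of times that index `j` occurs in a sequence of offers. -/
def offerCount {t : ℕ} (j : Fin K) (o : Fin t → Fin K) : ℕ :=
  ∑ s, if o s = j then 1 else 0

/-- The factor that a single step contributes to a likelihood ratio for a change of the demand law
at index `j`. -/
noncomputable def stepRatio (j : Fin K) (l : ℝ → ℝ) (x : Fin K × ℝ) : ENNReal :=
  if x.1 = j then ENNReal.ofReal (l x.2) else 1

/-- The likelihood ratio of a history. -/
noncomputable def likelihood (j : Fin K) (l : ℝ → ℝ) {t : ℕ} (h : History K t) : ENNReal :=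
  ∏ s, stepRatio j l (h s)

theorem measurable_stepRatio (j : Fin K) {l : ℝ → ℝ} (hl : Measurable l) :
    Measurable (stepRatio j l) :=
  Measurable.ite (measurable_fst (MeasurableSet.of_discrete (s := {j})))
    (hl.comp measurable_snd).ennreal_ofReal measurable_const

theorem measurable_likelihood (j : Fin K) {l : ℝ → ℝ} (hl : Measurable l) (t : ℕ) :
    Measurable (likelihood j l : History K t → ENNReal) :=
  Finset.measurable_prod _ fun s _ => (measurable_stepRatio j hl).comp (measurable_pi_apply s)

theorem likelihood_snoc (j : Fin K) (l : ℝ → ℝ) {t : ℕ} (x : History K t × (Fin K × ℝ)) :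
    likelihood j l (History.snoc x) = likelihood j l x.1 * stepRatio j l x.2 := by
  simp [likelihood, Fin.prod_univ_castSucc]

/-- The policy's own randomization is the same under both instances, because the prices agree, and
cancels; only demands observed at `j` contribute to the density. -/
theorem lintegral_historyLaw_eq (I J : PricingInstance K) (π : Policy K) (j : Fin K)
    {l : ℝ → ℝ} (hl : Measurable l) (hprice : J.price = I.price)
    (hne : ∀ i, i ≠ j → J.demand i = I.demand i)
    (hj : J.demand j = (I.demand j).withDensity fun d => ENNReal.ofReal (l d)) (t : ℕ)
    {f : History K t → ENNReal} (hf : Measurable f) :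
    ∫⁻ h, f h ∂(historyLaw J π t) = ∫⁻ h, f h * likelihood j l h ∂(historyLaw I π t) := by
  induction t with
  | zero => simp [historyLaw, likelihood]
  | succ t ih =>
    have hw := measurable_stepRatio j hl
    have hf' : Measurable fun x => f (History.snoc x) := hf.comp History.measurable_snoc
    rw [lintegral_historyLaw_succ J π t hf,
      lintegral_historyLaw_succ I π t (f := fun h => f h * likelihood j l h)
        (hf.mul (measurable_likelihood j hl _)),
      ih hf'.lintegral_kernel_prod_right']
    refine lintegral_congr fun h => ?_
    have hfh : Measurable fun x => f (History.snoc (h, x)) := hf'.comp measurable_prodMk_left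
    simp only [likelihood_snoc]
    calc (∫⁻ x, f (History.snoc (h, x)) ∂(stepKernel J π t h)) * likelihood j l h
        = (∫⁻ x, f (History.snoc (h, x)) * stepRatio j l x ∂(stepKernel I π t h)) *
            likelihood j l h := by
          congr 1
          rw [lintegral_stepKernel J π t h hfh, hprice, lintegral_stepKernel I π t h
            (f := fun x => f (History.snoc (h, x)) * stepRatio j l x) (hfh.mul hw)]
          refine lintegral_congr fun i => ?_
          by_cases hi : i = j
          · subst hi
            rw [hj, lintegral_withDensity_eq_lintegral_mul
              (g := fun d => f (History.snoc (h, i, d))) _ hl.ennreal_ofReal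
              (hfh.comp measurable_prodMk_left)]
            refine lintegral_congr fun d => ?_
            simp [stepRatio, mul_comm]
          · rw [hne i hi]
            simp [stepRatio, hi]
      _ = _ := by
          rw [← lintegral_mul_const (f := fun x => f (History.snoc (h, x)) * stepRatio j l x) _
            (hfh.mul hw)]
          refine lintegral_congr fun x => ?_
          ring

theorem offerCount_snoc (j : Fin K) {t : ℕ} (x : History K t × (Fin K × ℝ)) :
    offerCount j (History.snoc x).offers =
      offerCount j x.1.offers + if x.2.1 = j then 1 else 0 := by
  simp only [offerCount, Fin.sum_univ_castSucc, History.offers,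
    History.snoc_castSucc, History.snoc_last]
  rfl

theorem measurable_pow_offerCount (j : Fin K) (B : ENNReal) (t : ℕ) :
    Measurable fun h : History K t => B ^ offerCount j h.offers :=
  (Measurable.of_discrete (f := fun o : Fin t → Fin K => B ^ offerCount j o)).comp
    History.measurable_offers

/-- A supermartingale argument: an offer of `j` multiplies the inverse likelihood by a factor of
conditional mean at most `B`, which the discount `B⁻¹` offsets, and other offers change nothing. The
discount is needed because the number of offers of `j` is random. -/
theorem lintegral_inv_likelihood_le (I : PricingInstance K) (π : Policy K) (j : Fin K)
    {l : ℝ → ℝ} (hl : Measurable l) (hl0 : ∀ d, 0 < l d) {B : ENNReal} (hB1 : 1 ≤ B) (hB : B ≠ ⊤)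
    (hj : ∫⁻ d, (ENNReal.ofReal (l d))⁻¹ ∂(I.demand j) ≤ B) (t : ℕ) :
    ∫⁻ h : History K t, (likelihood j l h)⁻¹ * (B⁻¹) ^ offerCount j h.offers
      ∂(historyLaw I π t) ≤ 1 := by
  have hB0 : B ≠ 0 := (zero_lt_one.trans_le hB1).ne'
  induction t with
  | zero => simp [historyLaw, likelihood, offerCount]
  | succ t ih =>
    have hw := measurable_stepRatio j hl
    have hw0 : ∀ x, stepRatio j l x ≠ 0 := by
      intro x
      unfold stepRatio
      split_ifs
      · simpa using hl0 x.2
      · exact one_ne_zero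
    have hwt : ∀ x, stepRatio j l x ≠ ⊤ := by
      intro x
      unfold stepRatio
      split_ifs <;> simp
    rw [lintegral_historyLaw_succ I π t
      (f := fun h => (likelihood j l h)⁻¹ * (B⁻¹) ^ offerCount j h.offers)
      ((measurable_likelihood j hl _).inv.mul (measurable_pow_offerCount j _ _))]
    refine le_trans (lintegral_mono fun h => ?_) ih
    simp only [likelihood_snoc, offerCount_snoc]
    have hg : Measurable fun x : Fin K × ℝ =>
        (stepRatio j l x)⁻¹ * (B⁻¹) ^ (if x.1 = j then 1 else 0 : ℕ) :=
      hw.inv.mul ((Measurable.of_discrete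
        (f := fun i : Fin K => (B⁻¹) ^ (if i = j then 1 else 0 : ℕ))).comp measurable_fst)
    calc ∫⁻ x, (likelihood j l h * stepRatio j l x)⁻¹ *
          (B⁻¹) ^ (offerCount j h.offers + if x.1 = j then 1 else 0) ∂(stepKernel I π t h)
        = ∫⁻ x, ((likelihood j l h)⁻¹ * (B⁻¹) ^ offerCount j h.offers) *
            ((stepRatio j l x)⁻¹ * (B⁻¹) ^ (if x.1 = j then 1 else 0 : ℕ))
            ∂(stepKernel I π t h) := by
          refine lintegral_congr fun x => ?_
          rw [ENNReal.mul_inv (Or.inr (hwt x)) (Or.inr (hw0 x)), pow_add]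
          ring
      _ = ((likelihood j l h)⁻¹ * (B⁻¹) ^ offerCount j h.offers) *
            ∫⁻ x, (stepRatio j l x)⁻¹ * (B⁻¹) ^ (if x.1 = j then 1 else 0 : ℕ)
            ∂(stepKernel I π t h) := lintegral_const_mul _ hg
      _ ≤ ((likelihood j l h)⁻¹ * (B⁻¹) ^ offerCount j h.offers) * 1 := by
          gcongr
          rw [lintegral_stepKernel I π t h hg]
          have h1 := π.markov I.price t
          calc _ ≤ ∫⁻ i, 1 ∂(π.choose I.price t h) := by
                refine lintegral_mono fun i => ?_
                have := I.demand_prob i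
                by_cases hi : i = j
                · subst hi
                  simp only [stepRatio, if_true, pow_one]
                  rw [lintegral_mul_const (f := fun d => (ENNReal.ofReal (l d))⁻¹) _
                    hl.ennreal_ofReal.inv]
                  calc _ ≤ B * B⁻¹ := by gcongr
                    _ = 1 := ENNReal.mul_inv_cancel hB0 hB
                · simp [stepRatio, hi]
            _ = 1 := by simp
      _ = _ := mul_one _

/-- AM-GM, with equality at x = 1/8. Applied to the likelihood ratio, it trades a probability under
one law for one under the other plus a second-moment error. -/
theorem one_le_four_mul_add_inv {x : ENNReal} (h0 : x ≠ 0) (ht : x ≠ ⊤) :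
    1 ≤ 4 * x + 16⁻¹ * x⁻¹ := by
  lift x to NNReal using ht
  have hx : x ≠ 0 := by simpa using h0
  rw [← ENNReal.coe_inv hx]
  have : (1 : NNReal) ≤ 4 * x + 16⁻¹ * x⁻¹ := by
    rw [← NNReal.coe_le_coe]
    push_cast
    have hx' : (0 : ℝ) < x := by positivity
    have : (4 * x + 16⁻¹ * (x : ℝ)⁻¹ : ℝ) - 1 = (8 * x - 1) ^ 2 / (16 * x) := by
      field_simp
      ring
    have h2 : (0 : ℝ) ≤ (8 * x - 1) ^ 2 / (16 * x) := by positivity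
    linarith
  have h3 : (1 : ENNReal) ≤ ((4 * x + 16⁻¹ * x⁻¹ : NNReal) : ENNReal) := by exact_mod_cast this
  rwa [ENNReal.coe_add, ENNReal.coe_mul, ENNReal.coe_mul, ENNReal.coe_inv (by norm_num),
    ENNReal.coe_ofNat, ENNReal.coe_ofNat] at h3

/-- If two instances differ only in the demand law at index `j`, then an event on which `j` is
offered at most `m` times cannot be much less likely under the second instance. -/
theorem measure_historyLaw_le (I J : PricingInstance K) (π : Policy K) (j : Fin K)
    {l : ℝ → ℝ} (hl : Measurable l) (hl0 : ∀ d, 0 < l d) (hprice : J.price = I.price)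
    (hne : ∀ i, i ≠ j → J.demand i = I.demand i)
    (hj : J.demand j = (I.demand j).withDensity fun d => ENNReal.ofReal (l d))
    {B : ENNReal} (hB1 : 1 ≤ B) (hB : B ≠ ⊤)
    (hjB : ∫⁻ d, (ENNReal.ofReal (l d))⁻¹ ∂(I.demand j) ≤ B) {t m : ℕ}
    {S : Set (Fin t → Fin K)} (hS : ∀ o ∈ S, offerCount j o ≤ m) :
    historyLaw I π t (History.offers ⁻¹' S) ≤
      4 * historyLaw J π t (History.offers ⁻¹' S) + 16⁻¹ * B ^ m := by
  have hB0 : B ≠ 0 := (zero_lt_one.trans_le hB1).ne'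
  have hSm : MeasurableSet (History.offers ⁻¹' S : Set (History K t)) :=
    History.measurable_offers MeasurableSet.of_discrete
  have hL := measurable_likelihood (K := K) j hl t
  have hL0 : ∀ h : History K t, likelihood j l h ≠ 0 := by
    intro h
    refine Finset.prod_ne_zero_iff.2 fun s _ => ?_
    unfold stepRatio
    split_ifs
    · simpa using hl0 _
    · exact one_ne_zero
  have hLt : ∀ h : History K t, likelihood j l h ≠ ⊤ := by
    intro h
    refine ENNReal.prod_ne_top fun s _ => ?_
    unfold stepRatio
    split_ifs <;> simp
  set A : Set (History K t) := History.offers ⁻¹' S with hA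
  have hind : Measurable (A.indicator (1 : History K t → ENNReal)) :=
    measurable_one.indicator hSm
  calc historyLaw I π t A = ∫⁻ h, A.indicator 1 h ∂(historyLaw I π t) :=
        (lintegral_indicator_one hSm).symm
    _ ≤ ∫⁻ h, (4 * (A.indicator 1 h * likelihood j l h) + 16⁻¹ * B ^ m *
          ((likelihood j l h)⁻¹ * (B⁻¹) ^ offerCount j h.offers)) ∂(historyLaw I π t) := by
        refine lintegral_mono fun h => ?_
        by_cases hh : h ∈ A
        · simp only [Set.indicator_of_mem hh, Pi.one_apply, one_mul]
          refine (one_le_four_mul_add_inv (hL0 h) (hLt h)).trans ?_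
          refine add_le_add le_rfl ?_
          -- On `S` the count is at most `m`, so the factor `B ^ m` pays for the discount.
          have h1 : (1 : ENNReal) ≤ B ^ m * (B⁻¹) ^ offerCount j h.offers := by
            calc (1 : ENNReal) = B ^ m * (B⁻¹) ^ m := by
                  rw [← mul_pow, ENNReal.mul_inv_cancel hB0 hB, one_pow]
              _ ≤ _ := by
                  gcongr _ * ?_
                  exact pow_le_pow_right_of_le_one' (ENNReal.inv_le_one.2 hB1) (hS _ hh)
          calc 16⁻¹ * (likelihood j l h)⁻¹ = 16⁻¹ * (likelihood j l h)⁻¹ * 1 := (mul_one _).symm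
            _ ≤ 16⁻¹ * (likelihood j l h)⁻¹ * (B ^ m * (B⁻¹) ^ offerCount j h.offers) := by gcongr
            _ = _ := by ring
        · simp [Set.indicator_of_notMem hh]
    _ = 4 * historyLaw J π t A + 16⁻¹ * B ^ m * ∫⁻ h : History K t,
          (likelihood j l h)⁻¹ * (B⁻¹) ^ offerCount j h.offers ∂(historyLaw I π t) := by
        rw [lintegral_add_left (f := fun h => 4 * (A.indicator 1 h * likelihood j l h))
            ((hind.mul hL).const_mul 4),
          lintegral_const_mul (f := fun h => A.indicator 1 h * likelihood j l h) _ (hind.mul hL),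
          lintegral_const_mul
            (f := fun h => (likelihood j l h)⁻¹ * (B⁻¹) ^ offerCount j h.offers) _
            (hL.inv.mul (measurable_pow_offerCount j _ _)),
          ← lintegral_historyLaw_eq I J π j hl hprice hne hj t hind, lintegral_indicator_one hSm]
    _ ≤ 4 * historyLaw J π t A + 16⁻¹ * B ^ m * 1 := by
        gcongr
        exact lintegral_inv_likelihood_le I π j hl hl0 hB1 hB hjB t
    _ = _ := by rw [mul_one]

/-! ### Two-point demand laws -/

/-- The law on `{1/4, 1}` with mass `q` at `1`. -/
noncomputable def twoPoint (q : ℝ) : Measure ℝ :=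
  ENNReal.ofReal q • Measure.dirac 1 + ENNReal.ofReal (1 - q) • Measure.dirac (1 / 4)

theorem isProbabilityMeasure_twoPoint {q : ℝ} (h0 : 0 ≤ q) (h1 : q ≤ 1) :
    IsProbabilityMeasure (twoPoint q) := by
  constructor
  simp only [twoPoint, Measure.add_apply, Measure.smul_apply, measure_univ, smul_eq_mul, mul_one]
  rw [← ENNReal.ofReal_add h0 (by linarith)]
  simp

theorem ae_twoPoint {q : ℝ} {S : Set ℝ} (hS : MeasurableSet S) (h1 : (1 : ℝ) ∈ S)
    (h2 : (1 / 4 : ℝ) ∈ S) : ∀ᵐ x ∂(twoPoint q), x ∈ S := by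
  rw [twoPoint, ae_add_measure_iff]
  exact ⟨Measure.ae_smul_measure ((ae_dirac_iff hS).2 h1) _,
    Measure.ae_smul_measure ((ae_dirac_iff hS).2 h2) _⟩

theorem lintegral_twoPoint (q : ℝ) (f : ℝ → ENNReal) :
    ∫⁻ x, f x ∂(twoPoint q) = ENNReal.ofReal q * f 1 + ENNReal.ofReal (1 - q) * f (1 / 4) := by
  simp [twoPoint, lintegral_add_measure, lintegral_smul_measure]

theorem integral_id_twoPoint {q : ℝ} (h0 : 0 ≤ q) (h1 : q ≤ 1) :
    ∫ x, x ∂(twoPoint q) = (1 + 3 * q) / 4 := by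
  have hi : ∀ (a : ENNReal) (b : ℝ), a ≠ ⊤ → Integrable (fun x : ℝ => x) (a • Measure.dirac b) :=
    fun a b ha => (integrable_dirac (by simp)).smul_measure ha
  rw [twoPoint, integral_add_measure (hi _ _ (by simp)) (hi _ _ (by simp)),
    integral_smul_measure, integral_smul_measure, integral_dirac, integral_dirac,
    ENNReal.toReal_ofReal h0, ENNReal.toReal_ofReal (by linarith)]
  simp only [smul_eq_mul]
  ring

/-- The ratio of the masses of two laws on `{1/4, 1}`. -/
noncomputable def twoPointRatio (q q' : ℝ) (d : ℝ) : ℝ :=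
  if d = 1 then q' / q else (1 - q') / (1 - q)

theorem measurable_twoPointRatio (q q' : ℝ) : Measurable (twoPointRatio q q') :=
  Measurable.ite (measurableSet_singleton 1) measurable_const measurable_const

theorem twoPointRatio_pos {q q' : ℝ} (hq : q ∈ Set.Ioo (0 : ℝ) 1) (hq' : q' ∈ Set.Ioo (0 : ℝ) 1)
    (d : ℝ) : 0 < twoPointRatio q q' d := by
  unfold twoPointRatio
  split_ifs
  · exact div_pos hq'.1 hq.1
  · exact div_pos (by linarith [hq'.2]) (by linarith [hq.2])

theorem twoPoint_eq_withDensity {q q' : ℝ} (hq : q ∈ Set.Ioo (0 : ℝ) 1) :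
    twoPoint q' = (twoPoint q).withDensity fun d => ENNReal.ofReal (twoPointRatio q q' d) := by
  have hne : (1 / 4 : ℝ) ≠ 1 := by norm_num
  ext S hS
  rw [withDensity_apply _ hS, ← lintegral_indicator hS, lintegral_twoPoint,
    ← lintegral_indicator_one hS, lintegral_twoPoint]
  congr 1
  · by_cases h : (1 : ℝ) ∈ S
    · simp only [Set.indicator_of_mem h, Pi.one_apply, mul_one, twoPointRatio, if_true]
      rw [← ENNReal.ofReal_mul hq.1.le, mul_div_cancel₀ _ hq.1.ne']
    · simp [Set.indicator_of_notMem h]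
  · by_cases h : (1 / 4 : ℝ) ∈ S
    · simp only [Set.indicator_of_mem h, Pi.one_apply, mul_one, twoPointRatio, if_neg hne]
      have : 0 < 1 - q := by linarith [hq.2]
      rw [← ENNReal.ofReal_mul this.le, mul_div_cancel₀ _ this.ne']
    · simp only [Set.indicator_of_notMem h, mul_zero]

/-- The excess over 1 is the χ²-divergence of the law with parameter q from the one with parameter
q'. -/
theorem lintegral_inv_twoPointRatio {q q' : ℝ} (hq : q ∈ Set.Ioo (0 : ℝ) 1)
    (hq' : q' ∈ Set.Ioo (0 : ℝ) 1) :
    ∫⁻ d, (ENNReal.ofReal (twoPointRatio q q' d))⁻¹ ∂(twoPoint q) =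
      ENNReal.ofReal (1 + (q - q') ^ 2 / (q' * (1 - q'))) := by
  have hne : (1 / 4 : ℝ) ≠ 1 := by norm_num
  have h1 : 0 < 1 - q := by linarith [hq.2]
  have h1' : 0 < 1 - q' := by linarith [hq'.2]
  have h0 := hq.1
  have h0' := hq'.1
  rw [lintegral_twoPoint, ← ENNReal.ofReal_inv_of_pos (twoPointRatio_pos hq hq' _),
    ← ENNReal.ofReal_inv_of_pos (twoPointRatio_pos hq hq' _)]
  simp only [twoPointRatio, if_true, if_neg hne]
  rw [← ENNReal.ofReal_mul h0.le, ← ENNReal.ofReal_mul h1.le,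
    ← ENNReal.ofReal_add (by positivity) (by positivity)]
  congr 1
  field_simp
  ring

/-! ### The hard instances and their indistinguishability -/

variable {k : ℕ}

/-- The prices of the hard instances: one low price and `k` high prices. -/
noncomputable def hardPrice (i : Fin (k + 1)) : ℝ :=
  if i = 0 then 1 / 2 else 3 / 4 + (i : ℝ) / (8 * (k + 1))

/-- The one-step rewards of the hard instances: the low price has reward `1/2`, and a high price
has reward `1/2 - δ`, except that a nonzero index `j` has reward `1/2 + δ`. -/
noncomputable def hardReward (δ : ℝ) (j i : Fin (k + 1)) : ℝ :=
  if i = 0 then 1 / 2 else if i = j then 1 / 2 + δ else 1 / 2 - δ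

/-- The probability of the demand `1` in the hard instances. -/
noncomputable def hardProb (δ : ℝ) (j i : Fin (k + 1)) : ℝ :=
  (4 * hardReward δ j i / hardPrice i - 1) / 3

theorem hardPrice_mem {i : Fin (k + 1)} (hi : i ≠ 0) :
    hardPrice i ∈ Set.Icc (3 / 4 : ℝ) (7 / 8) := by
  have hk : (0 : ℝ) < 8 * (k + 1) := by positivity
  have : (i : ℝ) / (8 * (k + 1)) ≤ 1 / 8 := by
    rw [div_le_div_iff₀ hk (by norm_num)]
    have : (i : ℝ) ≤ k + 1 := by exact_mod_cast i.2.le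
    linarith
  have h0 : (0 : ℝ) ≤ (i : ℝ) / (8 * (k + 1)) := by positivity
  rw [hardPrice, if_neg hi]
  constructor <;> linarith

theorem hardPrice_strictMono : StrictMono (hardPrice : Fin (k + 1) → ℝ) := by
  intro a b hab
  have hb : b ≠ 0 := (lt_of_le_of_lt (Fin.zero_le a) hab).ne'
  by_cases ha : a = 0
  · have := (hardPrice_mem hb).1
    rw [ha]
    simp only [hardPrice, if_true] at this ⊢
    linarith
  · simp only [hardPrice, if_neg ha, if_neg hb]
    have : (a : ℝ) < b := by exact_mod_cast hab
    gcongr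

theorem hardProb_zero (δ : ℝ) (j : Fin (k + 1)) : hardProb δ j 0 = 1 := by
  norm_num [hardProb, hardReward, hardPrice]

/-- Keeping the parameter away from 0 and 1 bounds the χ²-divergence by a multiple of δ². The
extremes come from reward 7/16 at price 7/8 and reward 9/16 at price 3/4. -/
theorem hardProb_mem {δ : ℝ} (h0 : 0 ≤ δ) (h1 : δ ≤ 1 / 16) (j : Fin (k + 1)) {i : Fin (k + 1)}
    (hi : i ≠ 0) : hardProb δ j i ∈ Set.Icc (1 / 3 : ℝ) (2 / 3) := by
  obtain ⟨hp1, hp2⟩ := hardPrice_mem hi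
  have hp : 0 < hardPrice i := by linarith
  have hr : hardReward δ j i ∈ Set.Icc (7 / 16 : ℝ) (9 / 16) := by
    rw [hardReward, if_neg hi]
    split_ifs <;> constructor <;> linarith
  have h2 : 2 ≤ 4 * hardReward δ j i / hardPrice i := by
    rw [le_div_iff₀ hp]; linarith [hr.1]
  have h3 : 4 * hardReward δ j i / hardPrice i ≤ 3 := by
    rw [div_le_iff₀ hp]; linarith [hr.2]
  rw [hardProb]
  constructor <;> linarith

theorem hardProb_mem_unit {δ : ℝ} (h0 : 0 ≤ δ) (h1 : δ ≤ 1 / 16) (j i : Fin (k + 1)) :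
    0 ≤ hardProb δ j i ∧ hardProb δ j i ≤ 1 := by
  by_cases hi : i = 0
  · rw [hi, hardProb_zero]; norm_num
  · have := hardProb_mem h0 h1 j hi
    constructor <;> linarith [this.1, this.2]

/-- The hard instance with gap `δ` and good index `j`; for `j = 0` no high price is good. -/
noncomputable def hardInstance {δ : ℝ} (h0 : 0 ≤ δ) (h1 : δ ≤ 1 / 16) (j : Fin (k + 1)) :
    PricingInstance (k + 1) where
  price := hardPrice
  price_mem i := by
    by_cases hi : i = 0
    · simp only [hardPrice, if_pos hi]; norm_num
    · have := hardPrice_mem hi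
      constructor <;> linarith [this.1, this.2]
  price_strictMono := hardPrice_strictMono
  demand i := twoPoint (hardProb δ j i)
  demand_prob i := isProbabilityMeasure_twoPoint (hardProb_mem_unit h0 h1 j i).1
    (hardProb_mem_unit h0 h1 j i).2
  demand_mem i := ae_twoPoint measurableSet_Icc (by norm_num) (by norm_num)

section

variable {δ : ℝ} (h0 : 0 ≤ δ) (h1 : δ ≤ 1 / 16)

theorem reward_hardInstance (j i : Fin (k + 1)) :
    (hardInstance h0 h1 j).reward i = hardReward δ j i := by
  have hp : hardPrice i ≠ 0 := by
    by_cases hi : i = 0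
    · simp [hardPrice, hi]
    · linarith [(hardPrice_mem hi).1]
  have := hardProb_mem_unit h0 h1 j i
  change hardPrice i * ∫ x, x ∂(twoPoint (hardProb δ j i)) = _
  rw [integral_id_twoPoint this.1 this.2, hardProb]
  field_simp
  ring

theorem iSup_reward_hardInstance_zero :
    ⨆ i, (hardInstance h0 h1 (0 : Fin (k + 1))).reward i = 1 / 2 := by
  apply le_antisymm
  · refine ciSup_le fun i => ?_
    rw [reward_hardInstance, hardReward]
    split_ifs <;> linarith
  · refine le_ciSup_of_le (Set.finite_range _).bddAbove 0 ?_
    simp [reward_hardInstance, hardReward]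

theorem le_iSup_reward_hardInstance {j : Fin (k + 1)} (hj : j ≠ 0) :
    1 / 2 + δ ≤ ⨆ i, (hardInstance h0 h1 j).reward i := by
  refine le_ciSup_of_le (Set.finite_range _).bddAbove j ?_
  simp [reward_hardInstance, hardReward, hj]

theorem measure_hardInstance_le (π : Policy (k + 1)) {j : Fin (k + 1)} (hj : j ≠ 0) {t m : ℕ}
    {S : Set (Fin t → Fin (k + 1))} (hS : ∀ o ∈ S, offerCount j o ≤ m)
    (hm : 64 * δ ^ 2 * m ≤ 1 / 4) :
    (historyLaw (hardInstance h0 h1 0) π t).real (History.offers ⁻¹' S) ≤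
      4 * (historyLaw (hardInstance h0 h1 j) π t).real (History.offers ⁻¹' S) + 1 / 8 := by
  set q := hardProb δ 0 j with hq
  set q' := hardProb δ j j with hq'
  have hqm := hardProb_mem h0 h1 0 hj
  have hqm' := hardProb_mem h0 h1 j hj
  rw [← hq] at hqm
  rw [← hq'] at hqm'
  have hqo : q ∈ Set.Ioo (0 : ℝ) 1 := by constructor <;> linarith [hqm.1, hqm.2]
  have hqo' : q' ∈ Set.Ioo (0 : ℝ) 1 := by constructor <;> linarith [hqm'.1, hqm'.2]
  have hp := hardPrice_mem hj
  -- The parameters differ by 8δ/(3p) ≤ 32δ/9, and q'(1 - q') ≥ 2/9; the quotient is below 57δ².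
  have hchi : (q - q') ^ 2 / (q' * (1 - q')) ≤ 64 * δ ^ 2 := by
    have hd : q' - q = 8 * δ / hardPrice j / 3 := by
      simp only [hq, hq', hardProb, hardReward, if_neg hj, if_true]
      ring
    have hd1 : q' - q ≤ 32 / 9 * δ := by
      rw [hd, div_div, div_le_iff₀ (by linarith [hp.1])]
      nlinarith [hp.1]
    have hd0 : 0 ≤ q' - q := by
      rw [hd]
      have : 0 < hardPrice j := by linarith [hp.1]
      positivity
    have hprod : 2 / 9 ≤ q' * (1 - q') := by nlinarith [hqm'.1, hqm'.2]
    rw [div_le_iff₀ (by linarith)]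
    nlinarith [sq_nonneg δ, mul_le_mul hd1 hd1 hd0 (by linarith)]
  have key := measure_historyLaw_le (hardInstance h0 h1 0) (hardInstance h0 h1 j) π j
    (measurable_twoPointRatio q q') (twoPointRatio_pos hqo hqo') rfl
    (by
      intro i hi
      change twoPoint _ = twoPoint _
      by_cases hi0 : i = 0
      · rw [hi0, hardProb_zero, hardProb_zero]
      · simp [hardProb, hardReward, hi0, hi])
    (twoPoint_eq_withDensity hqo)
    (B := ENNReal.ofReal (1 + 64 * δ ^ 2)) (by simp; positivity) ENNReal.ofReal_ne_top
    ((lintegral_inv_twoPointRatio hqo hqo').trans_le (ENNReal.ofReal_le_ofReal (by linarith))) hS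
  -- This bounds the error term `16⁻¹ * B ^ m` by 1/8.
  have hpow : (1 + 64 * δ ^ 2) ^ m ≤ 2 := by
    calc (1 + 64 * δ ^ 2) ^ m ≤ Real.exp (64 * δ ^ 2) ^ m := by
          gcongr
          linarith [Real.add_one_le_exp (64 * δ ^ 2)]
      _ = Real.exp (64 * δ ^ 2 * m) := by rw [← Real.exp_nat_mul, mul_comm]
      _ ≤ Real.exp (1 / 4) := Real.exp_le_exp.2 hm
      _ ≤ 2 := by
          have := Real.exp_bound_div_one_sub_of_interval (x := 1 / 4) (by norm_num) (by norm_num)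
          linarith
  have hr := ENNReal.toReal_mono (by finiteness) key
  rw [ENNReal.toReal_add (by finiteness) (by finiteness), ENNReal.toReal_mul, ENNReal.toReal_mul,
    ENNReal.toReal_pow, ENNReal.toReal_ofReal (by positivity)] at hr
  simp only [ENNReal.toReal_ofNat, ENNReal.toReal_inv] at hr
  simp only [Measure.real]
  linarith

/-! ### Counting refunds -/

/-- Step `t` is refunded: a high price is offered, and the low price within the protection
period. -/
def IsRefunded (M : ℕ) {T : ℕ} (o : Fin T → Fin (k + 1)) (t : Fin T) : Prop :=
  o t ≠ 0 ∧ ∃ s : Fin T, t < s ∧ (s : ℕ) ≤ t + M ∧ o s = 0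

open scoped Classical in
/-- The number of refunded steps. -/
noncomputable def refundCount (M : ℕ) {T : ℕ} (o : Fin T → Fin (k + 1)) : ℕ :=
  (Finset.univ.filter fun t => IsRefunded M o t).card

open scoped Classical in
theorem revenue_add_refundCount_le (π : Policy (k + 1)) (M T : ℕ) (j : Fin (k + 1)) :
    ∀ᵐ h ∂(historyLaw (hardInstance h0 h1 j) π T),
      revenue M (hardInstance h0 h1 j).price h + 1 / 16 * (refundCount M h.offers : ℝ) ≤
        ∑ s, (hardInstance h0 h1 j).price (h s).1 * (h s).2 := by
  filter_upwards [ae_demand_mem (hardInstance h0 h1 j) π (S := Set.Icc (1 / 4) 1)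
    measurableSet_Icc (fun i => ae_twoPoint measurableSet_Icc (by norm_num) (by norm_num)) T]
    with h hh
  have hcount : (1 / 16 * (refundCount M h.offers : ℝ)) =
      ∑ t, if IsRefunded M h.offers t then (1 / 16 : ℝ) else 0 := by
    rw [refundCount, ← Finset.sum_filter, Finset.sum_const, nsmul_eq_mul, mul_comm]
  rw [hcount, revenue, ← Finset.sum_add_distrib]
  refine Finset.sum_le_sum fun t _ => ?_
  have hle : ∀ s : Fin T, t ≤ s → (s : ℕ) ≤ t + M →
      finalPrice M (hardInstance h0 h1 j).price h t ≤ hardPrice (h s).1 := by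
    intro s hs hs'
    exact Finset.inf'_le (f := fun s => hardPrice (h s).1) (by simpa using ⟨hs, hs'⟩)
  change _ ≤ hardPrice (h t).1 * (h t).2
  have hd := (hh t).1
  split_ifs with hr
  · obtain ⟨ht, s, hts, hsM, hs⟩ := hr
    have h2 := hle s hts.le hsM
    have h3 := (hardPrice_mem ht).1
    have hs' : (h s).1 = 0 := hs
    have h4 : hardPrice (h s).1 = 1 / 2 := by rw [hs', hardPrice, if_pos rfl]
    have h5 : 3 / 4 ≤ hardPrice (h t).1 := h3
    -- The price drops by at least 3/4 - 1/2 = 1/4 and the demand is at least 1/4, so the loss is at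
    -- least 1/16.
    nlinarith
  · have h2 := hle t le_rfl (by omega)
    rw [add_zero]
    gcongr

end

/-- The number of offers of high prices. -/
def highCount {t : ℕ} (o : Fin t → Fin (k + 1)) : ℕ :=
  (Finset.univ.filter fun s => o s ≠ 0).card

/-- Either every high offer before `s` is refunded, or some run of high offers outlasts the
protection period; then the last M steps of that run are all refunded when the low price returns. -/
theorem min_le_refundCount (M : ℕ) {T : ℕ} (o : Fin T → Fin (k + 1)) {s : Fin T} (hs : o s = 0) :
    min M (Finset.univ.filter fun t => t < s ∧ o t ≠ 0).card ≤ refundCount M o := by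
  classical
  by_cases hall : ∀ t, t < s → o t ≠ 0 → IsRefunded M o t
  · refine (min_le_right _ _).trans (Finset.card_le_card fun t ht => ?_)
    simp only [Finset.mem_filter, Finset.mem_univ, true_and] at ht ⊢
    exact hall t ht.1 ht.2
  · push Not at hall
    obtain ⟨t, hts, ht, hn⟩ := hall
    refine (min_le_left _ _).trans ?_
    -- The first low offer after the unrefunded step `t` ends the run; it lies more than M steps
    -- after `t`.
    have hex : ∃ n, ∃ h : n < T, (t : ℕ) < n ∧ o ⟨n, h⟩ = 0 := ⟨s, s.2, hts, hs⟩
    obtain ⟨hT, htn, hn0⟩ := Nat.find_spec hex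
    have hmin : ∀ n (hn : n < T), (t : ℕ) < n → n < Nat.find hex → o ⟨n, hn⟩ ≠ 0 :=
      fun n hn htn hlt h0 => Nat.find_min hex hlt ⟨hn, htn, h0⟩
    set n := Nat.find hex
    have hlate : (t : ℕ) + M < n := by
      by_contra hle
      exact hn ⟨ht, ⟨n, hT⟩, htn, by simpa using hle, hn0⟩
    calc M = (Finset.univ : Finset (Fin M)).card := by simp
      _ ≤ refundCount M o := by
        refine Finset.card_le_card_of_injOn
          (fun i : Fin M => (⟨n - M + i, by omega⟩ : Fin T)) ?_ ?_
        · intro i _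
          simp only [Finset.coe_filter, Finset.mem_univ, true_and, Set.mem_ofPred_eq]
          refine ⟨hmin _ _ (by omega) (by omega), ⟨n, hT⟩, ?_, ?_, hn0⟩
          · rw [Fin.lt_def]
            change n - M + i < n
            omega
          · change n ≤ n - M + i + M
            omega
        · intro a _ b _ hab
          simp only [Fin.mk.injEq] at hab
          exact Fin.ext (by omega)

/-! ### Restriction to the first half, and a rarely offered high price -/

/-- The first `t` entries of a sequence of offers. -/
def prefixOffers {t T : ℕ} (hT : t ≤ T) (o : Fin T → Fin (k + 1)) : Fin t → Fin (k + 1) :=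
  fun s => o (Fin.castLE hT s)

theorem measureReal_prefixOffers (I : PricingInstance (k + 1)) (π : Policy (k + 1)) {t T : ℕ}
    (hT : t ≤ T) (S : Set (Fin t → Fin (k + 1))) :
    (historyLaw I π T).real (History.offers ⁻¹' (prefixOffers hT ⁻¹' S)) =
      (historyLaw I π t).real (History.offers ⁻¹' S) := by
  rw [← historyLaw_map_take I π hT, map_measureReal_apply (History.measurable_take hT)
    (History.measurable_offers MeasurableSet.of_discrete)]
  rfl

theorem highCount_eq_sum {t : ℕ} (o : Fin t → Fin (k + 1)) :
    (highCount o : ℝ) = ∑ s, if o s = 0 then (0 : ℝ) else 1 := by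
  simp [highCount, Finset.card_filter]

theorem sum_castLE_le {t T : ℕ} (hT : t ≤ T) {f : Fin T → ℝ} (hf : ∀ s, 0 ≤ f s) :
    ∑ s : Fin t, f (Fin.castLE hT s) ≤ ∑ s, f s := by
  have := Finset.sum_map Finset.univ (Fin.castLEEmb hT) f
  simp only [Fin.coe_castLEEmb] at this
  rw [← this]
  exact Finset.sum_le_univ_sum_of_nonneg hf

theorem highCount_prefixOffers_le {t T : ℕ} (hT : t ≤ T) (o : Fin T → Fin (k + 1)) {s : Fin T}
    (hs : t ≤ s) :
    highCount (prefixOffers hT o) ≤ (Finset.univ.filter fun r => r < s ∧ o r ≠ 0).card := by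
  refine Finset.card_le_card_of_injOn (Fin.castLE hT) ?_ (Fin.castLE_injective hT).injOn
  intro r hr
  simp only [Finset.coe_filter, Finset.mem_univ, true_and, Set.mem_ofPred_eq] at hr ⊢
  exact ⟨by rw [Fin.lt_def]; exact lt_of_lt_of_le r.2 hs, hr⟩

theorem sum_offerCount {t : ℕ} (o : Fin t → Fin (k + 1)) :
    ∑ j ∈ Finset.univ.erase 0, (offerCount j o : ℝ) = highCount o := by
  rw [highCount_eq_sum]
  simp only [offerCount, Nat.cast_sum]
  rw [Finset.sum_comm]
  refine Finset.sum_congr rfl fun s _ => ?_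
  by_cases h : o s = 0 <;> simp [h]

/-- If few high prices are offered, then some high price is rarely offered. -/
theorem exists_offerCount_le (hk : 1 ≤ k) {t : ℕ} (ν : Measure (Fin t → Fin (k + 1)))
    [IsProbabilityMeasure ν] {n m : ℝ} (hm : 0 < m) (hnm : 3 * n ≤ k * m) :
    ∃ j : Fin (k + 1), j ≠ 0 ∧
      2 * ν.real {o | (highCount o : ℝ) ≤ n} ≤
        3 * ν.real ({o | (highCount o : ℝ) ≤ n} ∩ {o | (offerCount j o : ℝ) ≤ m}) := by
  by_contra! hcon
  set S : Set (Fin t → Fin (k + 1)) := {o | (highCount o : ℝ) ≤ n} with hS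
  -- Markov's inequality on `S`: if the claim fails for j, more than a third of `S` has over `m`
  -- offers of j. Summing over the k high prices contradicts the bound `n` on their total.
  have hstep : ∀ j ∈ (Finset.univ.erase (0 : Fin (k + 1))),
      m * ν.real S < 3 * ∫ o, S.indicator (fun o => (offerCount j o : ℝ)) o ∂ν := by
    intro j hj
    have h1 := hcon j (Finset.ne_of_mem_erase hj)
    set C : Set (Fin t → Fin (k + 1)) := {o | (offerCount j o : ℝ) ≤ m} with hC
    have h2 : ν.real (S ∩ C) + ν.real (S \ C) = ν.real S :=
      measureReal_inter_add_sdiff MeasurableSet.of_discrete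
    have h3 : m * ν.real (S \ C) ≤ ∫ o, S.indicator (fun o => (offerCount j o : ℝ)) o ∂ν := by
      calc m * ν.real (S \ C) = ∫ o, (S \ C).indicator (fun _ => m) o ∂ν := by
            rw [integral_indicator_const _ MeasurableSet.of_discrete, smul_eq_mul, mul_comm]
        _ ≤ _ := by
            refine integral_mono .of_finite .of_finite fun o => ?_
            by_cases ho : o ∈ S
            · by_cases hoC : o ∈ C
              · rw [Set.indicator_of_notMem (fun h => h.2 hoC), Set.indicator_of_mem ho]
                positivity
              · rw [Set.indicator_of_mem (show o ∈ S \ C from ⟨ho, hoC⟩), Set.indicator_of_mem ho]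
                exact (not_le.1 hoC).le
            · rw [Set.indicator_of_notMem (fun h => ho h.1), Set.indicator_of_notMem ho]
    nlinarith
  have hne : (Finset.univ.erase (0 : Fin (k + 1))).Nonempty :=
    Finset.card_pos.1 (by rw [Finset.card_erase_of_mem (Finset.mem_univ _)]; simp; omega)
  have hsum := Finset.sum_lt_sum_of_nonempty hne hstep
  rw [Finset.sum_const, Finset.card_erase_of_mem (Finset.mem_univ _), ← Finset.mul_sum,
    ← integral_finsetSum _ fun _ _ => .of_finite] at hsum
  have hle : ∫ o, ∑ j ∈ Finset.univ.erase (0 : Fin (k + 1)),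
      S.indicator (fun o => (offerCount j o : ℝ)) o ∂ν ≤ n * ν.real S := by
    calc _ ≤ ∫ o, S.indicator (fun _ => n) o ∂ν := by
          refine integral_mono .of_finite .of_finite fun o => ?_
          by_cases ho : o ∈ S
          · simp only [Set.indicator_of_mem ho, sum_offerCount]
            exact ho
          · simp [Set.indicator_of_notMem ho]
      _ = n * ν.real S := by
          rw [integral_indicator_const _ MeasurableSet.of_discrete, smul_eq_mul, mul_comm]
  simp only [Finset.card_univ, Fintype.card_fin, Nat.add_sub_cancel, nsmul_eq_mul] at hsum
  nlinarith [measureReal_nonneg (μ := ν) (s := S)]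

/-! ### The dichotomy: rare or frequent high offers -/

section

variable {δ : ℝ} (h0 : 0 ≤ δ) (h1 : δ ≤ 1 / 16)

theorem mul_highCount_eq_sum {T : ℕ} (o : Fin T → Fin (k + 1)) :
    ∑ s, ((⨆ i, (hardInstance h0 h1 (0 : Fin (k + 1))).reward i) -
      (hardInstance h0 h1 (0 : Fin (k + 1))).reward (o s)) = δ * highCount o := by
  rw [highCount_eq_sum, Finset.mul_sum, iSup_reward_hardInstance_zero]
  refine Finset.sum_congr rfl fun s _ => ?_
  rw [reward_hardInstance, hardReward]
  split_ifs <;> simp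

/-- If high prices are rarely offered in the first half of the horizon, then the regret is large
on the instance in which a suitable high price is good. -/
theorem exists_regret_ge_of_rare (hk : 1 ≤ k) (π : Policy (k + 1)) (M : ℕ) {T : ℕ} (hT : 2 ≤ T)
    {Y : ℝ} (hKY : (k : ℝ) + 1 ≤ Y) (hYT : Y ≤ T) (hδ : δ ^ 2 = (k + 1) / Y / 256)
    (hP : 1 / 2 ≤ (historyLaw (hardInstance h0 h1 0) π (T / 2)).real
      (History.offers ⁻¹' {o | (highCount o : ℝ) ≤ Y / 6})) :
    ∃ j : Fin (k + 1), δ * T / 192 ≤ regret M T (hardInstance h0 h1 j) π := by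
  have hK0 : (0 : ℝ) < k + 1 := by positivity
  have hY0 : 0 < Y := by linarith
  have hk' : (1 : ℝ) ≤ k := by exact_mod_cast hk
  set t := T / 2 with ht
  have htT : t ≤ T := by omega
  -- Despite rounding, the first half has at least T/3 steps, because T ≥ 2.
  have htT' : (T : ℝ) ≤ 3 * t := by
    have : T ≤ 3 * t := by omega
    exact_mod_cast this
  set P := historyLaw (hardInstance h0 h1 0) π t
  have hprob : IsProbabilityMeasure (P.map History.offers) :=
    Measure.isProbabilityMeasure_map History.measurable_offers.aemeasurable
  obtain ⟨j, hj, hPj⟩ := exists_offerCount_le hk (P.map History.offers) (n := Y / 6)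
    (m := Y / (k + 1)) (by positivity) (by
      rw [← mul_div_assoc (k : ℝ), le_div_iff₀ hK0]
      nlinarith)
  rw [map_measureReal_apply History.measurable_offers MeasurableSet.of_discrete,
    map_measureReal_apply History.measurable_offers MeasurableSet.of_discrete] at hPj
  set S : Set (Fin t → Fin (k + 1)) :=
    {o | (highCount o : ℝ) ≤ Y / 6} ∩ {o | (offerCount j o : ℝ) ≤ Y / (k + 1)} with hS
  have hchange := measure_hardInstance_le h0 h1 π hj (t := t) (m := ⌊Y / (k + 1)⌋₊) (S := S)
    (fun o ho => Nat.le_floor ho.2) (by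
      have : (⌊Y / (k + 1)⌋₊ : ℝ) ≤ Y / (k + 1) := Nat.floor_le (by positivity)
      calc 64 * δ ^ 2 * ⌊Y / (k + 1)⌋₊ ≤ 64 * δ ^ 2 * (Y / (k + 1)) := by gcongr
        _ = 1 / 4 := by rw [hδ]; field_simp; norm_num)
  -- The event has probability at least 1/3 without a good price, hence at least (1/3 - 1/8)/4 =
  -- 5/96 when `j` is good.
  have hPS : 1 / 32 ≤ (historyLaw (hardInstance h0 h1 j) π t).real (History.offers ⁻¹' S) := by
    linarith
  refine ⟨j, ?_⟩
  have hreg := mul_measure_le_regret (hardInstance h0 h1 j) π M T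
    (fun o => 1 / 16 * (refundCount M o : ℝ)) (fun o => by positivity)
    (revenue_add_refundCount_le h0 h1 π M T j) (prefixOffers htT ⁻¹' S) (b := δ * T / 6) (by
      intro o ho
      have hhigh : (highCount (prefixOffers htT o) : ℝ) ≤ Y / 6 := ho.1
      have hsup := le_iSup_reward_hardInstance h0 h1 hj
      have hnn : ∀ s, 0 ≤ (⨆ i, (hardInstance h0 h1 j).reward i) -
          (hardInstance h0 h1 j).reward (o s) := fun s =>
        sub_nonneg.2 (le_ciSup (Set.finite_range _).bddAbove _)
      have hlow : δ * (t - highCount (prefixOffers htT o)) ≤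
          ∑ s : Fin t, ((⨆ i, (hardInstance h0 h1 j).reward i) -
            (hardInstance h0 h1 j).reward (o (Fin.castLE htT s))) := by
        have hcard : (t : ℝ) = ∑ s : Fin t, (1 : ℝ) := by simp
        rw [highCount_eq_sum, hcard, ← Finset.sum_sub_distrib, Finset.mul_sum]
        refine Finset.sum_le_sum fun s _ => ?_
        by_cases hs : o (Fin.castLE htT s) = 0
        · simp only [prefixOffers, hs, if_true]
          have : (hardInstance h0 h1 j).reward 0 = 1 / 2 := by
            simp [reward_hardInstance, hardReward]
          linarith
        · simp only [prefixOffers, hs, if_false, sub_self, mul_zero]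
          exact hnn _
      have hsum := sum_castLE_le htT hnn
      have href : 0 ≤ 1 / 16 * (refundCount M o : ℝ) := by positivity
      -- At least T/3 - Y/6 ≥ T/6 low offers remain, and each loses δ.
      have : δ * (T / 6) ≤ δ * (t - highCount (prefixOffers htT o)) := by
        gcongr
        linarith
      linarith)
  rw [measureReal_prefixOffers] at hreg
  refine le_trans ?_ hreg
  have : 0 ≤ δ * T / 6 := by positivity
  nlinarith

/-- If high prices are often offered in the first half of the horizon, then the regret is large on
the instance without a good high price. -/
theorem regret_ge_of_often (π : Policy (k + 1)) (M : ℕ) {t T : ℕ} (htT : t ≤ T)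
    (S : Set (Fin t → Fin (k + 1))) {b : ℝ} (hb0 : 0 ≤ b)
    (hP : (historyLaw (hardInstance h0 h1 0) π t).real (History.offers ⁻¹' S) ≤ 1 / 2)
    (hb : ∀ o : Fin T → Fin (k + 1), prefixOffers htT o ∉ S →
      b ≤ δ * highCount o + 1 / 16 * (refundCount M o : ℝ)) :
    b / 2 ≤ regret M T (hardInstance h0 h1 0) π := by
  have hreg := mul_measure_le_regret (hardInstance h0 h1 0) π M T
    (fun o => 1 / 16 * (refundCount M o : ℝ)) (fun o => by positivity)
    (revenue_add_refundCount_le h0 h1 π M T 0) (prefixOffers htT ⁻¹' Sᶜ) (b := b)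
    (fun o ho => by rw [mul_highCount_eq_sum]; exact hb o ho)
  rw [measureReal_prefixOffers, Set.preimage_compl, probReal_compl_eq_one_sub
    (History.measurable_offers MeasurableSet.of_discrete)] at hreg
  nlinarith

end

theorem highCount_prefixOffers_le_highCount {t T : ℕ} (hT : t ≤ T) (o : Fin T → Fin (k + 1)) :
    (highCount (prefixOffers hT o) : ℝ) ≤ highCount o := by
  rw [highCount_eq_sum, highCount_eq_sum]
  exact sum_castLE_le hT (f := fun s => if o s = 0 then (0 : ℝ) else 1)
    fun s => by split_ifs <;> norm_num

theorem sub_le_highCount {t T : ℕ} (o : Fin T → Fin (k + 1)) (h : ∀ s : Fin T, t ≤ s → o s ≠ 0) :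
    T - t ≤ highCount o := by
  calc T - t = (Finset.univ : Finset (Fin (T - t))).card := by simp
    _ ≤ highCount o := by
      refine Finset.card_le_card_of_injOn (fun i => (⟨t + i, by omega⟩ : Fin T)) ?_ ?_
      · intro i _
        simp only [Finset.coe_filter, Finset.mem_univ, true_and, Set.mem_ofPred_eq]
        exact h _ (Nat.le_add_right _ _)
      · intro a _ b _ hab
        simp only [Fin.mk.injEq] at hab
        exact Fin.ext (by omega)

/-! ### Choice of the gap and the two lower bounds -/

/-- The gap at which `Y` offers of high prices do not suffice to find a good one. -/
noncomputable def gap (k : ℕ) (Y : ℝ) : ℝ := √((k + 1) / Y) / 16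

theorem gap_nonneg (k : ℕ) (Y : ℝ) : 0 ≤ gap k Y := by unfold gap; positivity

theorem gap_le {Y : ℝ} (hKY : (k : ℝ) + 1 ≤ Y) : gap k Y ≤ 1 / 16 := by
  have hY0 : 0 < Y := lt_of_lt_of_le (by positivity) hKY
  have : √((k + 1) / Y) ≤ 1 := Real.sqrt_le_one.2 ((div_le_one hY0).2 hKY)
  unfold gap
  linarith

theorem gap_sq {Y : ℝ} (hKY : (k : ℝ) + 1 ≤ Y) : gap k Y ^ 2 = (k + 1) / Y / 256 := by
  have hY0 : 0 < Y := lt_of_lt_of_le (by positivity) hKY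
  rw [gap, div_pow, Real.sq_sqrt (by positivity)]
  norm_num

/-- The budget is Y = T, and refunds are discarded. Since δT = √(KT)/16, the rare case gives the
constant 16 · 192 = 3072. -/
theorem exists_regret_ge_sqrt (hk : 1 ≤ k) (π : Policy (k + 1)) (M : ℕ) {T : ℕ}
    (hKT : k + 1 ≤ T) :
    ∃ I : PricingInstance (k + 1), √((k + 1) * T) / 3072 ≤ regret M T I π := by
  have hKY : (k : ℝ) + 1 ≤ T := by exact_mod_cast hKT
  have hT0 : (0 : ℝ) < T := lt_of_lt_of_le (by positivity) hKY
  have hgapT : gap k T * T = √((k + 1) * T) / 16 := by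
    have : ((k : ℝ) + 1) * T = (k + 1) / T * T ^ 2 := by field_simp
    rw [this, Real.sqrt_mul (by positivity), Real.sqrt_sq hT0.le, gap]
    ring
  have hs : 0 ≤ √(((k : ℝ) + 1) * T) := Real.sqrt_nonneg _
  rcases le_total (1 / 2) ((historyLaw (hardInstance (gap_nonneg k T) (gap_le hKY) 0) π
      (T / 2)).real (History.offers ⁻¹' {o | (highCount o : ℝ) ≤ T / 6})) with hP | hP
  · obtain ⟨j, hj⟩ := exists_regret_ge_of_rare (gap_nonneg k T) (gap_le hKY) hk π M (by omega) hKY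
      le_rfl (gap_sq hKY) hP
    exact ⟨_, le_trans (by linarith) hj⟩
  · refine ⟨_, le_trans ?_ (regret_ge_of_often (gap_nonneg k T) (gap_le hKY) π M
      (Nat.div_le_self T 2) _ (b := gap k T * (T / 6))
      (mul_nonneg (gap_nonneg _ _) (by positivity)) hP ?_)⟩
    · linarith
    · intro o ho
      have h1 := highCount_prefixOffers_le_highCount (Nat.div_le_self T 2) o
      have h2 : (T : ℝ) / 6 < highCount (prefixOffers (Nat.div_le_self T 2) o) := not_le.1 ho
      have h3 := mul_le_mul_of_nonneg_left (h2.le.trans h1) (gap_nonneg k T)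
      have : (0 : ℝ) ≤ 1 / 16 * (refundCount M o : ℝ) := by positivity
      linarith

/-- The budget is Y = X, small enough for δT ≥ X/16. Exploration is now paid for by refunds or by
abandoning the low price. -/
theorem exists_regret_ge_of_cube_le (hk : 1 ≤ k) (π : Policy (k + 1)) {M T : ℕ} (hT : 2 ≤ T)
    {X : ℝ} (hKX : (k : ℝ) + 1 ≤ X) (hXM : X ≤ M) (hXT : X ≤ T)
    (hX : X ^ 3 ≤ (k + 1) * (T : ℝ) ^ 2) :
    ∃ I : PricingInstance (k + 1), X / 3072 ≤ regret M T I π := by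
  have hX0 : 0 < X := lt_of_lt_of_le (by positivity) hKX
  have hgapT : X / 16 ≤ gap k X * T := by
    have : X ≤ √((k + 1) / X) * T := by
      rw [← Real.sqrt_sq (Nat.cast_nonneg T : (0 : ℝ) ≤ T), ← Real.sqrt_mul (by positivity)]
      refine Real.le_sqrt_of_sq_le ?_
      rw [div_mul_eq_mul_div, le_div_iff₀ hX0]
      linarith
    rw [gap]
    linarith
  rcases le_total (1 / 2) ((historyLaw (hardInstance (gap_nonneg k X) (gap_le hKX) 0) π
      (T / 2)).real (History.offers ⁻¹' {o | (highCount o : ℝ) ≤ X / 6})) with hP | hP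
  · obtain ⟨j, hj⟩ := exists_regret_ge_of_rare (gap_nonneg k X) (gap_le hKX) hk π M hT hKX
      hXT (gap_sq hKX) hP
    exact ⟨_, le_trans (by linarith) hj⟩
  · refine ⟨_, le_trans ?_ (regret_ge_of_often (gap_nonneg k X) (gap_le hKX) π M
      (Nat.div_le_self T 2) _ (b := X / 96) (by positivity) hP ?_)⟩
    · linarith
    · intro o ho
      have h2 : X / 6 < highCount (prefixOffers (Nat.div_le_self T 2) o) := not_le.1 ho
      -- A low offer in the second half comes after all the exploration counted so far and refunds
      -- at least X/6 steps, as X ≤ M. Without one, at least T/2 offers are high and lose δ each.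
      by_cases hlow : ∃ s : Fin T, T / 2 ≤ (s : ℕ) ∧ o s = 0
      · obtain ⟨s, hs, hos⟩ := hlow
        have h3 : (min M (highCount (prefixOffers (Nat.div_le_self T 2) o)) : ℕ) ≤
            refundCount M o :=
          (min_le_min_left _ (highCount_prefixOffers_le _ o hs)).trans
            (min_le_refundCount M o hos)
        have h4 : X / 6 ≤ (refundCount M o : ℝ) := by
          refine le_trans ?_ (Nat.cast_le.2 h3)
          rw [Nat.cast_min]
          exact le_min (by linarith) h2.le
        have := mul_nonneg (gap_nonneg k X) (Nat.cast_nonneg (α := ℝ) (highCount o))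
        linarith
      · push Not at hlow
        have h3 := sub_le_highCount o hlow
        have h4 : (T : ℝ) / 2 ≤ highCount o := by
          have : T ≤ 2 * highCount o := by omega
          have : (T : ℝ) ≤ 2 * highCount o := by exact_mod_cast this
          linarith
        have h5 := mul_le_mul_of_nonneg_left h4 (gap_nonneg k X)
        have : (0 : ℝ) ≤ 1 / 16 * (refundCount M o : ℝ) := by positivity
        linarith

end PriceProtection

theorem mainTheorem5 :
    ∃ c : ℝ, 0 < c ∧
      ∀ K M T : ℕ, 2 ≤ K → K < M → M ≤ T →
        ∀ π : PriceProtection.Policy K,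
          ∃ I : PriceProtection.PricingInstance K,
            c * (Real.sqrt ((K : ℝ) * T) +
                min (M : ℝ) ((K : ℝ) ^ (1 / 3 : ℝ) * (T : ℝ) ^ (2 / 3 : ℝ))) ≤
              PriceProtection.regret M T I π := by
  -- Half of 1/3072, since the larger of the two bounds is used.
  refine ⟨1 / 6144, by norm_num, ?_⟩
  intro K M T hK hKM hMT π
  obtain ⟨k, rfl⟩ : ∃ k, K = k + 1 := ⟨K - 1, by omega⟩
  have hk : 1 ≤ k := by omega
  have hKT : ((k + 1 : ℕ) : ℝ) ≤ T := by exact_mod_cast (hKM.trans_le hMT).le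
  have hMT' : (M : ℝ) ≤ T := by exact_mod_cast hMT
  have hK0 : (0 : ℝ) < (k + 1 : ℕ) := by positivity
  set Z : ℝ := ((k + 1 : ℕ) : ℝ) ^ (1 / 3 : ℝ) * (T : ℝ) ^ (2 / 3 : ℝ) with hZ
  have hZ3 : Z ^ 3 = (k + 1 : ℕ) * (T : ℝ) ^ 2 := by
    rw [hZ, mul_pow, ← Real.rpow_mul_natCast hK0.le, ← Real.rpow_mul_natCast (by positivity)]
    norm_num
  have hZ0 : 0 ≤ Z := by positivity
  -- Together with K < M this makes the budget min(M, Z) at least K, so that the gap is at most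
  -- 1/16.
  have hKZ : ((k + 1 : ℕ) : ℝ) ≤ Z := by
    refine le_of_pow_le_pow_left₀ (n := 3) (by norm_num) hZ0 ?_
    rw [hZ3]
    calc ((k + 1 : ℕ) : ℝ) ^ 3 = (k + 1 : ℕ) * ((k + 1 : ℕ) : ℝ) ^ 2 := by ring
      _ ≤ _ := by gcongr
  have hX3 : (min (M : ℝ) Z) ^ 3 ≤ (k + 1 : ℕ) * (T : ℝ) ^ 2 := by
    rw [← hZ3]
    exact pow_le_pow_left₀ (le_min (by positivity) hZ0) (min_le_right _ _) 3
  obtain ⟨I, hI⟩ := PriceProtection.exists_regret_ge_sqrt hk π M (hKM.trans_le hMT).le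
  obtain ⟨J, hJ⟩ := PriceProtection.exists_regret_ge_of_cube_le hk π (M := M) (T := T) (by omega)
    (X := min (M : ℝ) Z) (by exact_mod_cast le_min (by exact_mod_cast hKM.le) hKZ)
    (min_le_left _ _) ((min_le_left _ _).trans hMT') (by exact_mod_cast hX3)
  push_cast at hI hJ ⊢
  rcases le_total √(((k : ℝ) + 1) * T) (min (M : ℝ) Z) with h | h
  · exact ⟨J, by linarith⟩
  · exact ⟨I, by linarith⟩
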